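/- Let $p\ge 1$, $w\ge 1$, $n\ge 1$ be integers and let $a(t)=\sum_{k=p-w}^{p}a_kt^k$ be a Laurent polynomial with complex coefficients and $a_p\ne 0$ (put $a_k=0$ for $k>p$ and for $k<p-w$). Let $T_n(a)=[a_{j-k}]_{j,k=1}^n$ be the corresponding banded Toeplitz matrix and let $x$ be an eigenvalue of $T_n(a)$. Then $a-x$ has exactly $w$ zeros $z_1,\dots,z_w\in\mathbb{C}$, counted with multiplicity, in the sense that $a(t)-x=a_p\,t^{p-w}\prod_{j=1}^{w}(t-z_j)$ (so some $z_j$ may be $0$), and the vector $v=[v_r]_{r=1}^n$ with components \[ v_r=s_{((n-1)^{p-1},\,n-r)}(z_1,\dots,z_w) \] satisfies $T_n(a)v=xv$. Here $((n-1)^{p-1},n-r)$ is the partition consisting of $p-1$ parts equal to $n-1$ followed by the part $n-r$, and $s_\lambda=\det[h_{\lambda_j-j+k}]_{j,k=1}^{\ell(\lambda)}$ is the Schur polynomial of the partition $\lambda$, where $\ell(\lambda)$ is the number of parts of $\lambda$, $h_m$ is the complete homogeneous symmetric polynomial of degree $m$, and $h_m=0$ for $m<0$. (The vector $v$ is not claimed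 to be nonzero.) If moreover $1\le p\le w$ and the zeros $z_1,\dots,z_w$ are pairwise distinct, then there are complex numbers $C_1,\dots,C_w$, not depending on $r$, such that \[ v_r=\sum_{j=1}^{w}C_j\,z_j^{\,n-r+w-p}\qquad(r=1,\dots,n) \] (with $0^0=1$); explicitly, one can take \[ C_j=\frac{(-1)^{p-1}\,(\operatorname{adj}D)_{j,1}}{V}, \qquad D=\bigl[z_k^{\lambda_i+w-i}\bigr]_{i,k=1}^{w}, \qquad V=\prod_{1\le j<k\le w}(z_j-z_k), \] where $\lambda=(n^p,0^{w-p})$, that is, $\lambda_i=n$ for $i\le p$ and $\lambda_i=0$ for $p<i\le w$. -/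

import Mathlib

open scoped LaurentPolynomial

noncomputable section

/-- `a(t) = ∑_{k=p-w}^{p} a_k t^k` with `a_p ≠ 0`. The coefficient `a_{p-w}` may vanish. -/
def IsBandedSymbol (p w : ℕ) (a : ℂ[T;T⁻¹]) : Prop :=
  a.coeff (p : ℤ) ≠ 0 ∧ ∀ k : ℤ, k < (p : ℤ) - (w : ℤ) ∨ (p : ℤ) < k → a.coeff k = 0

/-- `z_1, …, z_w` is the list of zeros (with multiplicities) of the Laurent polynomial `b` of the
form `∑_{k=p-w}^{p} b_k t^k`: `b(t) = b_p t^{p-w} ∏_j (t - z_j)`. -/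
def IsZeroList (p w : ℕ) (b : ℂ[T;T⁻¹]) (z : Fin w → ℂ) : Prop :=
  b = LaurentPolynomial.C (b.coeff (p : ℤ)) * LaurentPolynomial.T ((p : ℤ) - (w : ℤ)) *
    ∏ j : Fin w, (LaurentPolynomial.T 1 - LaurentPolynomial.C (z j))

/-- The Toeplitz matrix `T_n(a) = [a_{j-k}]_{j,k=1}^n`. -/
def toeplitz (n : ℕ) (a : ℂ[T;T⁻¹]) : Matrix (Fin n) (Fin n) ℂ :=
  Matrix.of fun j k => a.coeff ((j : ℤ) - (k : ℤ))

/-- The complete homogeneous symmetric polynomial `h_k` in `w` variables, for an integer `k`;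
it is zero for `k < 0`. -/
def completeHomogeneous (w : ℕ) (k : ℤ) : MvPolynomial (Fin w) ℂ :=
  if 0 ≤ k then MvPolynomial.hsymm (Fin w) ℂ k.toNat else 0

/-- The Schur polynomial `s_l` in `w` variables of the partition `l = (l_1 ≥ l_2 ≥ … ≥ 0)`
(trailing zeros allowed), by the Jacobi-Trudi formula `s_l = det [h_{l_j - j + k}]_{j,k}`. -/
def schurPoly (w : ℕ) (l : List ℕ) : MvPolynomial (Fin w) ℂ :=
  Matrix.det (Matrix.of fun j k : Fin l.length =>
    completeHomogeneous w ((l.get j : ℤ) - (j : ℤ) + (k : ℤ)))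

/-- The value `s_l(z_1, …, z_w)`. -/
def schurEval {w : ℕ} (l : List ℕ) (z : Fin w → ℂ) : ℂ :=
  MvPolynomial.eval z (schurPoly w l)

/-- The generalized Vandermonde matrix `A_l(z_1, …, z_w) = [z_k^{l_j + w - j}]_{j,k=1}^w`, for a
partition `l` of length at most `w`, extended by zeros. Here `j` runs from `0` to `w - 1`, so
that the exponent `w - j` becomes `w - 1 - j`. -/
def genVandermonde {w : ℕ} (l : List ℕ) (z : Fin w → ℂ) : Matrix (Fin w) (Fin w) ℂ :=
  Matrix.of fun j k => z k ^ (l.getD (j : ℕ) 0 + (w - 1 - (j : ℕ)))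

/-- The constants `C_j = (-1)^{p-1} adj(D)_{j,1} / V`, where `D = A_{(n^p)}(z_1, …, z_w)` and
`V = det A_{(0^w)}(z_1, …, z_w) = ∏_{j<k} (z_j - z_k)`. -/
def trenchCoeff (n p : ℕ) {w : ℕ} (z : Fin w → ℂ) (j : Fin w) : ℂ :=
  (-1) ^ (p - 1) * (genVandermonde (List.replicate p n) z).adjugate j ⟨0, j.pos⟩ /
    (genVandermonde [] z).det

end

/-! Put b = a - x, E = ∏(1 - z_j X) and H = 1/E = ∑ h_m X^m. Then b_k = b_p E_{p-k}, so T_n(b) is,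
up to the factor b_p, a Toeplitz matrix in the coefficients of E, and E·H = 1 gives linear relations
among the rows R_s = (h_{n-s}, …, h_{n-s+p-1}). Apply to such a relation the functional L(u) = det
of the matrix with rows R_1, …, R_{p-1}, u. The rows R_1, …, R_{p-1} drop out by repetition, R_{p+r}
(r from 0) gives v_r, and what remains is T_n(b)v = 0 up to the term L(R_0), which is ± s_{(n^p)}.
It vanishes because a null vector of T_n(b) produces a common null vector of R_0, …, R_{p-1}
(`exists_null_vector_of_toeplitz_null`, `sum_zcoeff_mul_det_updateRow`). For distinct zeros, the
bialternant formula `det_genVandermonde` turns v_r into a quotient of determinants; expanding the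
numerator along the only row depending on r gives the powers of z_j. -/

/-- The coefficient of `X ^ k` in a power series, for an integer `k`; it is zero for `k < 0`. -/
noncomputable def zcoeff (f : PowerSeries ℂ) (k : ℤ) : ℂ :=
  if 0 ≤ k then PowerSeries.coeff k.toNat f else 0

theorem zcoeff_natCast (f : PowerSeries ℂ) (k : ℕ) : zcoeff f k = PowerSeries.coeff k f := by
  simp [zcoeff]

theorem zcoeff_of_neg (f : PowerSeries ℂ) {k : ℤ} (hk : k < 0) : zcoeff f k = 0 := by
  simp [zcoeff, not_le.mpr hk]

theorem zcoeff_one (k : ℤ) : zcoeff 1 k = if k = 0 then 1 else 0 := by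
  rcases lt_or_ge k 0 with hk | hk
  · rw [zcoeff_of_neg _ hk, if_neg hk.ne]
  · lift k to ℕ using hk
    simp [zcoeff_natCast, PowerSeries.coeff_one]

/-- The coefficients of a product, with both index ranges shifted. -/
theorem sum_zcoeff_mul_zcoeff (f g : PowerSeries ℂ) (M j : ℕ) (N : ℤ) (hN : N < M) :
    ∑ s ∈ Finset.range M, zcoeff f ((s : ℤ) - j) * zcoeff g (N - s) = zcoeff (f * g) (N - j) := by
  rcases lt_or_ge (N - j) 0 with h | h
  · rw [zcoeff_of_neg _ h]
    refine Finset.sum_eq_zero fun s _ => ?_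
    rcases lt_or_ge ((s : ℤ) - j) 0 with h' | h'
    · rw [zcoeff_of_neg _ h', zero_mul]
    · rw [zcoeff_of_neg g (by lia), mul_zero]
  · obtain ⟨d, hd⟩ := Int.eq_ofNat_of_zero_le h
    obtain ⟨e, he⟩ : ∃ e : ℕ, M = j + (d + 1) + e := ⟨M - (j + (d + 1)), by lia⟩
    rw [hd, zcoeff_natCast, PowerSeries.coeff_mul, Finset.Nat.sum_antidiagonal_eq_sum_range_succ_mk,
      he, Finset.sum_range_add, Finset.sum_range_add,
      Finset.sum_eq_zero (s := Finset.range j), Finset.sum_eq_zero (s := Finset.range e), zero_add,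
      add_zero]
    · refine Finset.sum_congr rfl fun s hs => ?_
      have hs' : s ≤ d := Nat.lt_succ_iff.mp (Finset.mem_range.mp hs)
      rw [show ((j + s : ℕ) : ℤ) - j = (s : ℕ) by push_cast; ring,
        show N - ((j + s : ℕ) : ℤ) = ((d - s : ℕ) : ℤ) by push_cast [Nat.cast_sub hs']; lia,
        zcoeff_natCast, zcoeff_natCast]
    · intro s _
      rw [zcoeff_of_neg g (by push_cast; lia), mul_zero]
    · intro s hs
      have := Finset.mem_range.mp hs
      rw [zcoeff_of_neg f (by lia), zero_mul]

/-! ### Generating functions of the symmetric polynomials -/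

/-- The power series `∑ h_m(z) X ^ m`. -/
noncomputable def hsymmSeries {w : ℕ} (z : Fin w → ℂ) : PowerSeries ℂ :=
  PowerSeries.mk fun m => MvPolynomial.eval z (MvPolynomial.hsymm (Fin w) ℂ m)

/-- The polynomial `∏ (1 - z_j X)`, the generating function of the signed elementary symmetric
polynomials. -/
noncomputable def esymmProd {w : ℕ} (z : Fin w → ℂ) : Polynomial ℂ :=
  ∏ j, (1 - Polynomial.C (z j) * Polynomial.X)

theorem eval_completeHomogeneous {w : ℕ} (z : Fin w → ℂ) (k : ℤ) :
    MvPolynomial.eval z (completeHomogeneous w k) = zcoeff (hsymmSeries z) k := by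
  unfold completeHomogeneous zcoeff hsymmSeries
  split_ifs <;> simp

/-- Multisets of size m in the index set correspond to exponent vectors of total degree m. -/
theorem hsymmSeries_eq_prod {w : ℕ} (z : Fin w → ℂ) :
    hsymmSeries z = ∏ j, PowerSeries.mk fun m => z j ^ m := by
  ext m
  rw [PowerSeries.coeff_prod, hsymmSeries, PowerSeries.coeff_mk, MvPolynomial.hsymm, map_sum]
  refine Finset.sum_bij (fun s _ => (Sym.equivNatSum (Fin w) m s : Fin w →₀ ℕ)) ?_ ?_ ?_ ?_
  · intro s _
    rw [Finset.mem_finsuppAntidiag]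
    refine ⟨?_, Finset.subset_univ _⟩
    have := (Sym.equivNatSum (Fin w) m s).2
    rwa [Finsupp.sum_fintype _ _ (by simp)] at this
  · intro s _ t _ h
    exact (Sym.equivNatSum (Fin w) m).injective (Subtype.ext h)
  · intro l hl
    have h : l.sum (fun _ => id) = m := by
      rw [Finsupp.sum_fintype _ _ (by simp)]
      exact (Finset.mem_finsuppAntidiag.mp hl).1
    exact ⟨(Sym.equivNatSum (Fin w) m).symm ⟨l, h⟩, Finset.mem_univ _, by simp⟩
  · intro s _
    rw [map_multiset_prod, Multiset.map_map, Finset.prod_multiset_map_count,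
      Finset.prod_subset (Finset.subset_univ _)]
    · simp
    · intro i _ hi
      simp only [Multiset.mem_toFinset] at hi
      rw [Multiset.count_eq_zero_of_notMem hi, pow_zero]

theorem one_sub_mul_mk_pow (c : ℂ) :
    ((1 - Polynomial.C c * Polynomial.X : Polynomial ℂ) : PowerSeries ℂ) *
      PowerSeries.mk (fun m => c ^ m) = 1 := by
  ext m
  cases m with
  | zero => simp [sub_mul, mul_assoc]
  | succ m =>
    simp [sub_mul, mul_assoc, PowerSeries.coeff_succ_X_mul, PowerSeries.coeff_one, pow_succ']

theorem esymmProd_mul_hsymmSeries {w : ℕ} (z : Fin w → ℂ) :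
    (esymmProd z : PowerSeries ℂ) * hsymmSeries z = 1 := by
  rw [hsymmSeries_eq_prod, esymmProd, ← Polynomial.coeToPowerSeries.ringHom_apply, map_prod,
    ← Finset.prod_mul_distrib]
  exact Finset.prod_eq_one fun j _ => one_sub_mul_mk_pow (z j)

/-! ### Laurent polynomials and their zeros -/

theorem coeff_toLaurent_eq_zcoeff (f : Polynomial ℂ) (k : ℤ) :
    (Polynomial.toLaurent f).coeff k = zcoeff f k := by
  rw [LaurentPolynomial.coeff_toLaurent]
  rcases lt_or_ge k 0 with hk | hk
  · rw [zcoeff_of_neg _ hk, Finsupp.mapDomain_of_notMem_range]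
    rintro ⟨m, rfl⟩
    exact absurd (Int.natCast_nonneg m) (not_le.mpr hk)
  · lift k to ℕ using hk
    rw [zcoeff_natCast, Polynomial.coeff_coe]
    exact Finsupp.mapDomain_apply Nat.castEmbedding.injective _ _

theorem coeff_C_mul_T_mul (f : ℂ[T;T⁻¹]) (c : ℂ) (m k : ℤ) :
    (LaurentPolynomial.C c * LaurentPolynomial.T m * f).coeff k = c * f.coeff (k - m) := by
  rw [← LaurentPolynomial.single_eq_C_mul_T]
  conv_lhs => rw [show k = m + (k - m) by ring]
  rw [AddMonoidAlgebra.coeff_single_mul_add]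

/-- The coefficients of a Laurent polynomial in terms of the list of its zeros. -/
theorem IsZeroList.coeff_eq {p w : ℕ} {b : ℂ[T;T⁻¹]} {z : Fin w → ℂ} (h : IsZeroList p w b z)
    (k : ℤ) : b.coeff k = b.coeff p * zcoeff (esymmProd z) (p - k) := by
  -- Factorwise, t - z_j = t(1 - z_j t⁻¹).
  have key : ∏ j : Fin w, (LaurentPolynomial.T 1 - LaurentPolynomial.C (z j)) =
      LaurentPolynomial.T (w : ℤ) *
        LaurentPolynomial.invert (Polynomial.toLaurent (esymmProd z)) := by
    rw [esymmProd, map_prod, map_prod, show (LaurentPolynomial.T (w : ℤ) : ℂ[T;T⁻¹]) =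
      ∏ _j : Fin w, LaurentPolynomial.T 1 by simp [LaurentPolynomial.T_pow],
      ← Finset.prod_mul_distrib]
    refine Finset.prod_congr rfl fun j _ => ?_
    rw [map_sub, map_sub, map_mul, map_mul, Polynomial.toLaurent_C, Polynomial.toLaurent_X,
      LaurentPolynomial.invert_C, LaurentPolynomial.invert_T, map_one, map_one, mul_sub, mul_one,
      mul_left_comm, ← LaurentPolynomial.T_add]
    simp
  conv_lhs => rw [h, key]
  rw [← mul_assoc, mul_assoc (LaurentPolynomial.C _), ← LaurentPolynomial.T_add,
    coeff_C_mul_T_mul, LaurentPolynomial.invert_apply, coeff_toLaurent_eq_zcoeff]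
  congr 2
  ring

theorem exists_isZeroList {p w : ℕ} {b : ℂ[T;T⁻¹]} (hb : IsBandedSymbol p w b) :
    ∃ z : Fin w → ℂ, IsZeroList p w b z := by
  -- P = t^{w-p} b is an ordinary polynomial of degree exactly w; its roots are the required zeros.
  set P : Polynomial ℂ := ∑ i ∈ Finset.range (w + 1),
    Polynomial.monomial i (b.coeff ((p : ℤ) - w + i)) with hP
  have hcoeff : ∀ i, P.coeff i = if i < w + 1 then b.coeff ((p : ℤ) - w + i) else 0 := by
    intro i
    simp [hP, Polynomial.finsetSum_coeff, Polynomial.coeff_monomial]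
  have hw : P.coeff w = b.coeff p := by
    rw [hcoeff, if_pos (Nat.lt_succ_self w)]
    congr 1
    ring
  have hdeg : P.natDegree = w := by
    refine Polynomial.natDegree_eq_of_le_of_coeff_ne_zero ?_ (by rw [hw]; exact hb.1)
    rw [Polynomial.natDegree_le_iff_coeff_eq_zero]
    intro i hi
    rw [hcoeff, if_neg (by lia)]
  have hlead : P.leadingCoeff = b.coeff p := by rw [Polynomial.leadingCoeff, hdeg, hw]
  have hbP : b = LaurentPolynomial.C 1 * LaurentPolynomial.T ((p : ℤ) - w) *
      Polynomial.toLaurent P := by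
    refine LaurentPolynomial.ext fun k => ?_
    rw [coeff_C_mul_T_mul, one_mul, coeff_toLaurent_eq_zcoeff]
    rcases lt_or_ge (k - ((p : ℤ) - w)) 0 with hk | hk
    · rw [zcoeff_of_neg _ hk]
      exact hb.2 k (Or.inl (by lia))
    · obtain ⟨d, hd⟩ := Int.eq_ofNat_of_zero_le hk
      rw [hd, zcoeff_natCast, Polynomial.coeff_coe, hcoeff]
      split_ifs with hdw
      · congr 1
        lia
      · exact hb.2 k (Or.inr (by lia))
  have hsplit : P.Splits := IsAlgClosed.splits P
  obtain ⟨z, hz⟩ : ∃ z : Fin w → ℂ, P.roots = (List.ofFn z : Multiset ℂ) := by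
    have hlist : ∀ (m : ℕ) (l : List ℂ), l.length = m → ∃ z : Fin m → ℂ, l = List.ofFn z := by
      rintro m l rfl
      exact ⟨l.get, (List.ofFn_get l).symm⟩
    obtain ⟨z, hz⟩ := hlist w P.roots.toList
      (by rw [Multiset.length_toList, ← hsplit.natDegree_eq_card_roots, hdeg])
    exact ⟨z, by rw [← hz, Multiset.coe_toList]⟩
  have hprod : P = Polynomial.C (b.coeff p) *
      ∏ j : Fin w, (Polynomial.X - Polynomial.C (z j)) := by
    conv_lhs => rw [hsplit.eq_prod_roots, hlead, hz, Multiset.map_coe, Multiset.prod_coe,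
      List.map_ofFn, List.prod_ofFn]
    rfl
  refine ⟨z, ?_⟩
  unfold IsZeroList
  conv_lhs => rw [hbP, hprod]
  rw [map_mul, map_prod, Polynomial.toLaurent_C, map_one, one_mul, mul_left_comm, mul_assoc]
  simp only [map_sub, Polynomial.toLaurent_X, Polynomial.toLaurent_C]

/-! ### Toeplitz null vectors and Jacobi-Trudi minors -/

theorem schurEval_eq_det {w q : ℕ} (l : List ℕ) (hl : l.length = q) (z : Fin w → ℂ) :
    schurEval l z = Matrix.det (Matrix.of fun i k : Fin q =>
      zcoeff (hsymmSeries z) ((l.getD i 0 : ℤ) - (i : ℕ) + (k : ℕ))) := by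
  subst hl
  rw [schurEval, schurPoly, RingHom.map_det]
  congr 1
  ext i k
  simp [eval_completeHomogeneous]

/-- The matrix of `h_{n - 1 - i + k}`, whose determinant is the Schur polynomial of a rectangle with
row length `n - 1`. -/
noncomputable def rectMatrix (q n : ℕ) (h : PowerSeries ℂ) : Matrix (Fin (q + 1)) (Fin (q + 1)) ℂ :=
  Matrix.of fun i k => zcoeff h ((n : ℤ) - 1 - (i : ℕ) + (k : ℕ))

theorem schurEval_replicate_append {w q n r : ℕ} (hr : r < n) (z : Fin w → ℂ) :
    schurEval (List.replicate q (n - 1) ++ [n - (r + 1)]) z =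
      ((rectMatrix q n (hsymmSeries z)).updateRow (Fin.last q)
        fun k => zcoeff (hsymmSeries z) ((n : ℤ) - (r + 1) - q + (k : ℕ))).det := by
  rw [schurEval_eq_det (q := q + 1) _ (by simp)]
  congr 1
  ext i k
  refine Fin.lastCases ?_ (fun i => ?_) i
  · rw [Matrix.updateRow_self, Matrix.of_apply]
    simp only [Fin.val_last, List.getD_eq_getElem?_getD]
    rw [List.getElem?_append_right (by simp)]
    congr 1
    simp
    lia
  · rw [Matrix.updateRow_ne (Fin.castSucc_ne_last i), Matrix.of_apply, rectMatrix, Matrix.of_apply]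
    simp only [Fin.val_castSucc, List.getD_eq_getElem?_getD]
    rw [List.getElem?_append_left (by simp)]
    congr 1
    simp
    lia

/-- If `f h = 1` and the Toeplitz matrix built from the coefficients of `f` has the null vector `y`,
then the rows `h_{n - s}, …, h_{n - s + q}` for `s = 0, …, q` have a common null vector. -/
theorem exists_null_vector_of_toeplitz_null {f h : PowerSeries ℂ} (hfh : f * h = 1) {q n : ℕ}
    {y : Fin n → ℂ} (hy0 : y ≠ 0)
    (hy : ∀ j < n, ∑ r : Fin n, zcoeff f ((q : ℤ) + 1 - j + (r : ℕ)) * y r = 0) :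
    ∃ c : Fin (q + 1) → ℂ, c ≠ 0 ∧
      ∀ s < q + 1, ∑ k : Fin (q + 1), zcoeff h ((n : ℤ) - s + (k : ℕ)) * c k = 0 := by
  -- Reversing y turns the Toeplitz sums into coefficients of Y·f.
  let Y : PowerSeries ℂ := PowerSeries.mk fun i => if hi : i < n then y (Fin.rev ⟨i, hi⟩) else 0
  have hYlt : ∀ i : Fin n, zcoeff Y (i : ℕ) = y (Fin.rev i) := by
    intro i
    rw [zcoeff_natCast, PowerSeries.coeff_mk, dif_pos i.2]
  have hYge : ∀ i : ℕ, n ≤ i → zcoeff Y i = 0 := by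
    intro i hi
    rw [zcoeff_natCast, PowerSeries.coeff_mk, dif_neg (not_lt.mpr hi)]
  -- Y·f has a gap: its coefficients in degrees q+1, …, q+n vanish.
  have hR : ∀ j < n, zcoeff (Y * f) ((q : ℤ) + n - j) = 0 := by
    intro j hj
    have hconv := sum_zcoeff_mul_zcoeff Y f (n + (q + 1)) 0 ((q : ℤ) + n - j) (by push_cast; lia)
    rw [Nat.cast_zero, sub_zero] at hconv
    rw [← hconv, Finset.sum_range_add, Finset.sum_eq_zero (s := Finset.range (q + 1)), add_zero,
      Finset.sum_range, ← hy j hj, ← Equiv.sum_comp Fin.revPerm]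
    · refine Finset.sum_congr rfl fun r _ => ?_
      rw [sub_zero, hYlt, Fin.revPerm_apply, Fin.rev_rev, mul_comm]
      congr 2
      rw [Fin.val_rev, Nat.cast_sub (by lia)]
      push_cast
      ring
    · intro s _
      rw [sub_zero, hYge _ (Nat.le_add_right n s), zero_mul]
  -- Y = (Y·f)·h; because of the gap, below degree q+1+n only the coefficients of Y·f up to degree q
  -- contribute.
  have hY : ∀ N : ℤ, N < (q + 1 + n : ℕ) → zcoeff Y N =
      ∑ k : Fin (q + 1), zcoeff h (N - q + (k : ℕ)) * zcoeff (Y * f) ((q : ℤ) - (k : ℕ)) := by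
    intro N hN
    have hconv := sum_zcoeff_mul_zcoeff (Y * f) h (q + 1 + n) 0 N hN
    rw [mul_assoc, hfh, mul_one, Nat.cast_zero, sub_zero] at hconv
    rw [← hconv, Finset.sum_range_add, Finset.sum_eq_zero (s := Finset.range n), add_zero,
      Finset.sum_range, ← Equiv.sum_comp Fin.revPerm]
    · refine Finset.sum_congr rfl fun k _ => ?_
      rw [sub_zero, mul_comm, Fin.revPerm_apply, Fin.val_rev, Nat.cast_sub (by lia)]
      congr 2
      · push_cast
        ring
      · push_cast
        ring
    · intro s hs
      have hs' := Finset.mem_range.mp hs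
      have := hR (n - 1 - s) (by lia)
      rw [show (q : ℤ) + n - ((n - 1 - s : ℕ) : ℤ) = ((q + 1 + s : ℕ) : ℤ) by lia] at this
      rw [sub_zero, this, zero_mul]
  -- If these coefficients all vanished, so would Y. The relations come from Y having no terms in
  -- degrees n, …, n+q.
  refine ⟨fun k => zcoeff (Y * f) ((q : ℤ) - (k : ℕ)), fun hc => hy0 ?_, fun s hs => ?_⟩
  · ext r
    rw [← Fin.rev_rev r, ← hYlt, hY _ (by have := (Fin.rev r).2; push_cast; lia)]
    refine Finset.sum_eq_zero fun k _ => ?_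
    rw [show zcoeff (Y * f) ((q : ℤ) - (k : ℕ)) = 0 from congrFun hc k, mul_zero]
  · have := hY ((n + (q - s) : ℕ) : ℤ) (by push_cast; lia)
    rw [hYge _ (Nat.le_add_right _ _)] at this
    rw [this]
    refine Finset.sum_congr rfl fun k _ => ?_
    congr 2
    lia

/-- The Toeplitz matrix of the coefficients of `f = 1 / h` annihilates the vector of minors. -/
theorem sum_zcoeff_mul_det_updateRow {f h : PowerSeries ℂ} (hfh : f * h = 1) {q n : ℕ}
    {y : Fin n → ℂ} (hy0 : y ≠ 0)
    (hy : ∀ j < n, ∑ r : Fin n, zcoeff f ((q : ℤ) + 1 - j + (r : ℕ)) * y r = 0)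
    {j : ℕ} (hj : j < n) :
    ∑ r : Fin n, zcoeff f ((q : ℤ) + 1 - j + (r : ℕ)) *
      ((rectMatrix q n h).updateRow (Fin.last q)
        fun k => zcoeff h ((n : ℤ) - ((r : ℕ) + 1) - q + (k : ℕ))).det = 0 := by
  set A := rectMatrix q n h with hA
  let L : (Fin (q + 1) → ℂ) →ₗ[ℂ] ℂ :=
    Matrix.detRowAlternating.toMultilinearMap.toLinearMap A (Fin.last q)
  have hL : ∀ u, L u = (A.updateRow (Fin.last q) u).det := fun u => rfl
  let row : ℕ → Fin (q + 1) → ℂ := fun s k => zcoeff h ((n : ℤ) + (k : ℕ) - s)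
  -- Entry k is the coefficient of f·h = 1 in degree n+k-j, which is positive since j < n.
  have hconv : ∑ s ∈ Finset.range (q + 1 + n), zcoeff f ((s : ℤ) - j) • row s = 0 := by
    ext k
    simp only [Finset.sum_apply, Pi.smul_apply, smul_eq_mul, Pi.zero_apply, row]
    rw [sum_zcoeff_mul_zcoeff _ _ _ _ _ (by have := k.2; push_cast; lia), hfh, zcoeff_one,
      if_neg (by lia)]
  have hrow : ∀ s < q, L (row (s + 1)) = 0 := by
    intro s hs
    rw [hL]
    refine Matrix.det_zero_of_row_eq (i := ⟨s, by lia⟩) (j := Fin.last q)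
      (fun e => by simp [Fin.ext_iff] at e; lia) ?_
    rw [Matrix.updateRow_self, Matrix.updateRow_ne (fun e => by simp [Fin.ext_iff] at e; lia)]
    ext k
    simp only [hA, rectMatrix, Matrix.of_apply, row]
    congr 1
    push_cast
    ring
  -- The only use of the null vector y.
  have hrow0 : L (row 0) = 0 := by
    obtain ⟨c, hc0, hc⟩ := exists_null_vector_of_toeplitz_null hfh hy0 hy
    rw [hL, ← Matrix.exists_mulVec_eq_zero_iff]
    refine ⟨c, hc0, ?_⟩
    ext i
    rw [Matrix.mulVec, dotProduct, Pi.zero_apply]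
    refine Fin.lastCases ?_ (fun i => ?_) i
    · rw [Matrix.updateRow_self, ← hc 0 (Nat.succ_pos q)]
      refine Finset.sum_congr rfl fun k _ => ?_
      simp only [row]
      rw [show (n : ℤ) + (k : ℕ) - ((0 : ℕ) : ℤ) = n - ((0 : ℕ) : ℤ) + (k : ℕ) by ring]
    · rw [Matrix.updateRow_ne (Fin.castSucc_ne_last i), ← hc (i + 1) (by lia)]
      refine Finset.sum_congr rfl fun k _ => ?_
      simp only [hA, rectMatrix, Matrix.of_apply]
      congr 2
      push_cast [Fin.val_castSucc]
      ring
  have := congrArg L hconv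
  rw [Finset.sum_range_add, Finset.sum_range_succ', map_add, map_add, map_sum, map_sum, map_smul,
    hrow0, Finset.sum_eq_zero, smul_zero, add_zero, zero_add, map_zero,
    Finset.sum_range fun s => L (zcoeff f (((q + 1 + s : ℕ) : ℤ) - j) • row (q + 1 + s))] at this
  · rw [← this]
    refine Finset.sum_congr rfl fun r _ => ?_
    rw [map_smul, hL, smul_eq_mul]
    congr 2
    · push_cast
      ring
    · congr 1
      ext k
      simp only [row]
      congr 1
      push_cast
      ring
  · intro s hs
    rw [map_smul, hrow s (Finset.mem_range.mp hs), smul_zero]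

/-! ### The bialternant formula -/

/-- The Jacobi-Trudi determinant may be enlarged by zero parts. -/
theorem schurEval_eq_det_of_length_le {w N : ℕ} (l : List ℕ) (hl : l.length ≤ N)
    (z : Fin w → ℂ) :
    schurEval l z = Matrix.det (Matrix.of fun i k : Fin N =>
      zcoeff (hsymmSeries z) ((l.getD i 0 : ℤ) - (i : ℕ) + (k : ℕ))) := by
  obtain ⟨m, rfl⟩ := Nat.exists_eq_add_of_le hl
  have hzero : ∀ i, l.length ≤ i → l.getD i 0 = 0 := fun i hi => by
    rw [List.getD_eq_getElem?_getD, List.getElem?_eq_none hi, Option.getD_none]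
  rw [schurEval_eq_det l rfl, ← Matrix.det_submatrix_equiv_self finSumFinEquiv]
  rw [← Matrix.fromBlocks_toBlocks (Matrix.submatrix _ _ _)]
  rw [show Matrix.toBlocks₂₁ (Matrix.submatrix _ (finSumFinEquiv (m := l.length) (n := m)) _) = 0
    from ?_, Matrix.det_fromBlocks_zero₂₁]
  -- The added diagonal block is unitriangular, since h_0 = 1 and h_m = 0 for m < 0.
  · rw [Matrix.det_of_isUpperTriangular (M := Matrix.toBlocks₂₂ _), Finset.prod_eq_one, mul_one]
    · rfl
    · intro i _
      simp only [Matrix.toBlocks₂₂, Matrix.of_apply, Matrix.submatrix_apply,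
        finSumFinEquiv_apply_right, Fin.val_natAdd]
      rw [hzero _ (Nat.le_add_right _ _), Nat.cast_zero, zero_sub, neg_add_cancel,
        ← Nat.cast_zero, zcoeff_natCast, hsymmSeries, PowerSeries.coeff_mk,
        MvPolynomial.hsymm_zero, map_one]
    · intro i j hij
      have hij : (j : ℕ) < i := hij
      simp only [Matrix.toBlocks₂₂, Matrix.of_apply, Matrix.submatrix_apply,
        finSumFinEquiv_apply_right, Fin.val_natAdd]
      rw [hzero _ (Nat.le_add_right _ _), zcoeff_of_neg]
      push_cast
      lia
  · ext i j
    simp only [Matrix.toBlocks₂₁, Matrix.of_apply, Matrix.submatrix_apply,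
      finSumFinEquiv_apply_right, finSumFinEquiv_apply_left, Fin.val_natAdd, Fin.val_castAdd,
      Matrix.zero_apply]
    rw [hzero _ (Nat.le_add_right _ _), zcoeff_of_neg]
    have := j.2
    push_cast
    lia

/-- The polynomial `∏_{l ≠ k} (1 - z_l X)`. -/
noncomputable def esymmProdErase {w : ℕ} (z : Fin w → ℂ) (k : Fin w) : Polynomial ℂ :=
  ∏ j ∈ Finset.univ.erase k, (1 - Polynomial.C (z j) * Polynomial.X)

/-- All factors of E except the k-th cancel against H. -/
theorem mk_pow_eq_esymmProdErase_mul_hsymmSeries {w : ℕ} (z : Fin w → ℂ) (k : Fin w) :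
    PowerSeries.mk (fun m => z k ^ m) = (esymmProdErase z k : PowerSeries ℂ) * hsymmSeries z := by
  have h1 := one_sub_mul_mk_pow (z k)
  have h2 := esymmProd_mul_hsymmSeries z
  rw [esymmProd, ← Finset.mul_prod_erase _ _ (Finset.mem_univ k), Polynomial.coe_mul] at h2
  change _ * (esymmProdErase z k : PowerSeries ℂ) * _ = 1 at h2
  linear_combination (esymmProdErase z k : PowerSeries ℂ) * hsymmSeries z * h1 -
    (PowerSeries.mk (fun m => z k ^ m)) * h2

theorem natDegree_esymmProdErase_lt {w : ℕ} (z : Fin w → ℂ) (k : Fin w) :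
    (esymmProdErase z k).natDegree < w := by
  refine lt_of_le_of_lt (Polynomial.natDegree_prod_le _ _) ?_
  refine lt_of_le_of_lt (Finset.sum_le_card_nsmul _ _ 1 fun j _ => ?_) ?_
  · refine (Polynomial.natDegree_sub_le _ _).trans ?_
    rw [Polynomial.natDegree_one, Nat.zero_max]
    exact (Polynomial.natDegree_C_mul_le _ _).trans Polynomial.natDegree_X_le
  · rw [Finset.card_erase_of_mem (Finset.mem_univ k), Finset.card_fin, smul_eq_mul, mul_one]
    exact Nat.sub_lt k.pos one_pos

/-- Powers of the variables as combinations of complete homogeneous symmetric polynomials. -/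
theorem pow_eq_sum_zcoeff_mul {w : ℕ} (z : Fin w → ℂ) (k : Fin w) (e : ℕ) :
    z k ^ e = ∑ j : Fin w, zcoeff (hsymmSeries z) ((e : ℤ) - w + 1 + (j : ℕ)) *
      zcoeff (esymmProdErase z k) ((w : ℤ) - 1 - (j : ℕ)) := by
  have hconv := sum_zcoeff_mul_zcoeff (esymmProdErase z k) (hsymmSeries z) (w + (e + 1)) 0 e
    (by push_cast; lia)
  rw [← mk_pow_eq_esymmProdErase_mul_hsymmSeries, Nat.cast_zero, sub_zero, zcoeff_natCast,
    PowerSeries.coeff_mk] at hconv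
  rw [← hconv, Finset.sum_range_add, Finset.sum_eq_zero (s := Finset.range (e + 1)), add_zero,
    Finset.sum_range, ← Equiv.sum_comp Fin.revPerm]
  · refine Finset.sum_congr rfl fun j _ => ?_
    rw [sub_zero, mul_comm, Fin.revPerm_apply, Fin.val_rev, Nat.cast_sub (by lia)]
    congr 2
    · push_cast
      ring
    · push_cast
      ring
  · intro s _
    rw [sub_zero, zcoeff_natCast, Polynomial.coeff_coe, Polynomial.coeff_eq_zero_of_natDegree_lt,
      zero_mul]
    exact (natDegree_esymmProdErase_lt z k).trans_le (Nat.le_add_right _ _)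

theorem schurEval_nil {w : ℕ} (z : Fin w → ℂ) : schurEval [] z = 1 := by
  rw [schurEval, schurPoly, Matrix.det_fin_zero, map_one]

/-- The bialternant formula. -/
theorem det_genVandermonde {w : ℕ} (l : List ℕ) (hl : l.length ≤ w) (z : Fin w → ℂ) :
    (genVandermonde l z).det = schurEval l z * (genVandermonde [] z).det := by
  -- M does not depend on l, so the case l = [] identifies its determinant with V.
  let M : Matrix (Fin w) (Fin w) ℂ :=
    Matrix.of fun j k => zcoeff (esymmProdErase z k) ((w : ℤ) - 1 - (j : ℕ))
  have key : ∀ l : List ℕ, l.length ≤ w → (genVandermonde l z).det = schurEval l z * M.det := by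
    intro l hl
    rw [schurEval_eq_det_of_length_le l hl, ← Matrix.det_mul]
    congr 1
    ext i k
    rw [Matrix.mul_apply, genVandermonde, Matrix.of_apply, pow_eq_sum_zcoeff_mul]
    refine Finset.sum_congr rfl fun j _ => ?_
    simp only [Matrix.of_apply, M]
    congr 2
    have := i.2
    lia
  rw [key l hl, key [] (Nat.zero_le _), schurEval_nil, one_mul]

theorem det_genVandermonde_nil_ne_zero {w : ℕ} {z : Fin w → ℂ} (hz : Function.Injective z) :
    (genVandermonde [] z).det ≠ 0 := by
  have h : genVandermonde [] z = (Matrix.vandermonde z).transpose.submatrix Fin.revPerm id := by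
    ext i k
    simp only [genVandermonde, Matrix.of_apply, Matrix.submatrix_apply, Matrix.transpose_apply,
      Matrix.vandermonde_apply, List.getD_nil, Fin.revPerm_apply, Fin.val_rev, id]
    congr 1
    lia
  rw [h, Matrix.det_permute, Matrix.det_transpose]
  exact mul_ne_zero (by exact_mod_cast (Equiv.Perm.sign _).ne_zero)
    (Matrix.det_vandermonde_ne_zero_iff.mpr hz)

/-! ### Expansion in powers of distinct zeros -/

/-- The first row of `A_{(n^{q+1})}` can be replaced so that, up to a cyclic permutation of the rows,
one obtains `A_l` for `l = ((n-1)^q, m)`. -/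
theorem det_updateRow_genVandermonde {w q n m : ℕ} (hq : q + 1 ≤ w) (hn : 1 ≤ n) (z : Fin w → ℂ)
    (hw : 0 < w) :
    ((genVandermonde (List.replicate (q + 1) n) z).updateRow ⟨0, hw⟩
      fun k => z k ^ (m + (w - (q + 1)))).det =
      (-1) ^ q * (genVandermonde (List.replicate q (n - 1) ++ [m]) z).det := by
  set D := (genVandermonde (List.replicate (q + 1) n) z).updateRow ⟨0, hw⟩
      fun k => z k ^ (m + (w - (q + 1))) with hD
  let i₀ : Fin w := ⟨q, hq⟩
  have h : genVandermonde (List.replicate q (n - 1) ++ [m]) z =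
      D.submatrix (Fin.cycleRange i₀) id := by
    ext i k
    rw [Matrix.submatrix_apply, id]
    have hget : (List.replicate q (n - 1) ++ [m]).getD i 0 =
        if (i : ℕ) < q then n - 1 else if (i : ℕ) = q then m else 0 := by
      rw [List.getD_eq_getElem?_getD]
      split_ifs with h1 h2
      · rw [List.getElem?_append_left (by simpa using h1)]
        simp [h1]
      · simp [h2]
      · rw [List.getElem?_eq_none (by simp; lia), Option.getD_none]
    have hget' : ∀ s : ℕ, (List.replicate (q + 1) n).getD s 0 = if s < q + 1 then n else 0 := by
      intro s
      rw [List.getD_eq_getElem?_getD, List.getElem?_replicate]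
      split_ifs <;> rfl
    rcases lt_trichotomy i i₀ with hi | hi | hi
    -- Moving down one row lowers w-1-i by one, which offsets the change of part from n-1 to n.
    · have hv : (Fin.cycleRange i₀ i : ℕ) = i + 1 := Fin.coe_cycleRange_of_lt hi
      have hi' : (i : ℕ) < q := hi
      rw [hD, Matrix.updateRow_ne (fun e => by simp [e] at hv), genVandermonde, genVandermonde,
        Matrix.of_apply, Matrix.of_apply, hget, hget', if_pos hi', hv, if_pos (by lia)]
      congr 1
      lia
    · have hv : Fin.cycleRange i₀ i = ⟨0, hw⟩ := by
        rw [Fin.ext_iff, Fin.coe_cycleRange_of_le hi.le, if_pos hi]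
      have hi' : (i : ℕ) = q := congrArg Fin.val hi
      rw [hD, hv, Matrix.updateRow_self, genVandermonde, Matrix.of_apply, hget,
        if_neg (by lia), if_pos hi', hi']
      congr 1
      lia
    · have hi' : q < (i : ℕ) := hi
      rw [Fin.cycleRange_of_gt hi, hD,
        Matrix.updateRow_ne (fun e => by simp [Fin.ext_iff] at e; lia), genVandermonde,
        genVandermonde, Matrix.of_apply, Matrix.of_apply, hget, hget', if_neg (by lia),
        if_neg (by lia), if_neg (by lia)]
  rw [h, Matrix.det_permute, Fin.sign_cycleRange, ← mul_assoc]
  push_cast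
  rw [← pow_add, Even.neg_one_pow ⟨q, rfl⟩, one_mul]

/-- The expansion of a Schur polynomial of `((n-1)^q, m)` in powers of distinct variables. -/
theorem schurEval_eq_sum_trenchCoeff_mul_pow {w q n m : ℕ} (hq : q + 1 ≤ w) (hn : 1 ≤ n)
    {z : Fin w → ℂ} (hz : Function.Injective z) :
    schurEval (List.replicate q (n - 1) ++ [m]) z =
      ∑ j, trenchCoeff n (q + 1) z j * z j ^ (m + (w - (q + 1))) := by
  have hw : 0 < w := by lia
  have hV := det_genVandermonde_nil_ne_zero hz
  have h1 := det_genVandermonde (List.replicate q (n - 1) ++ [m]) (by simpa using hq) z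
  have h2 := det_updateRow_genVandermonde (m := m) hq hn z hw
  -- Cramer's rule expands the determinant along the replaced row, with cofactors (adj D)_{j,1}.
  rw [← Matrix.cramer_transpose_apply, Matrix.cramer_eq_adjugate_mulVec,
    ← Matrix.adjugate_transpose, h1] at h2
  simp only [Matrix.mulVec, dotProduct, Matrix.transpose_apply] at h2
  have h3 : ((-1 : ℂ) ^ q) * (-1) ^ q = 1 := by rw [← pow_add, Even.neg_one_pow ⟨q, rfl⟩]
  simp only [trenchCoeff, Nat.add_sub_cancel]
  simp only [div_mul_eq_mul_div, mul_assoc]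
  rw [← Finset.sum_div, ← Finset.mul_sum, h2, eq_div_iff hV, ← mul_assoc, h3, one_mul]

/-! ### Passage from a to a - x -/

theorem coeff_sub_C_of_ne_zero (a : ℂ[T;T⁻¹]) (x : ℂ) {k : ℤ} (hk : k ≠ 0) :
    (a - LaurentPolynomial.C x).coeff k = a.coeff k := by
  rw [AddMonoidAlgebra.coeff_sub, Finsupp.sub_apply, LaurentPolynomial.C_apply, if_neg hk, sub_zero]

theorem toeplitz_sub_C (n : ℕ) (a : ℂ[T;T⁻¹]) (x : ℂ) :
    toeplitz n (a - LaurentPolynomial.C x) = toeplitz n a - x • (1 : Matrix (Fin n) (Fin n) ℂ) := by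
  ext i j
  simp only [toeplitz, Matrix.of_apply, Matrix.sub_apply, Matrix.smul_apply, smul_eq_mul]
  rcases eq_or_ne i j with rfl | hij
  · simp
  · rw [coeff_sub_C_of_ne_zero _ _ (by rw [Fin.ne_iff_vne] at hij; lia), Matrix.one_apply_ne hij]
    simp

theorem toeplitz_mulVec_eq_smul_iff (n : ℕ) (a : ℂ[T;T⁻¹]) (x : ℂ) (v : Fin n → ℂ) :
    (toeplitz n a).mulVec v = x • v ↔
      (toeplitz n (a - LaurentPolynomial.C x)).mulVec v = 0 := by
  rw [toeplitz_sub_C, Matrix.sub_mulVec, Matrix.smul_mulVec, Matrix.one_mulVec, sub_eq_zero]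

/-- If the band lies strictly below the diagonal, then `0` is the only eigenvalue. -/
theorem eq_zero_of_toeplitz_mulVec_eq_smul {n : ℕ} {a : ℂ[T;T⁻¹]} (ha : ∀ k ≤ 0, a.coeff k = 0)
    {x : ℂ} {y : Fin n → ℂ} (hy : y ≠ 0) (h : (toeplitz n a).mulVec y = x • y) : x = 0 := by
  by_contra hx
  refine hy (funext fun i => ?_)
  induction i using WellFoundedLT.induction with
  | ind i ih =>
    have hi := congrFun h i
    rw [Matrix.mulVec, dotProduct, Finset.sum_eq_zero, Pi.smul_apply, smul_eq_mul] at hi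
    · exact (mul_eq_zero.mp hi.symm).resolve_left hx
    · intro j _
      rcases lt_or_ge j i with hj | hj
      · rw [ih j hj, Pi.zero_apply, mul_zero]
      · rw [toeplitz, Matrix.of_apply, ha _ (by rw [Fin.le_def] at hj; lia), zero_mul]

/-- For p ≤ w, degree 0 lies in the band and differs from p. For w < p it lies outside, but then
T_n(a) is strictly lower triangular and x = 0. -/
theorem IsBandedSymbol.sub_C {p w n : ℕ} (hp : 1 ≤ p) {a : ℂ[T;T⁻¹]} (ha : IsBandedSymbol p w a)
    {x : ℂ} {y : Fin n → ℂ} (hy : y ≠ 0) (h : (toeplitz n a).mulVec y = x • y) :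
    IsBandedSymbol p w (a - LaurentPolynomial.C x) := by
  rcases lt_or_ge w p with hwp | hwp
  · rw [eq_zero_of_toeplitz_mulVec_eq_smul (fun k hk => ha.2 k (Or.inl (by lia))) hy h, map_zero,
      sub_zero]
    exact ha
  · refine ⟨?_, fun k hk => ?_⟩
    · rw [coeff_sub_C_of_ne_zero _ _ (by lia)]
      exact ha.1
    · rw [coeff_sub_C_of_ne_zero _ _ (by lia)]
      exact ha.2 k hk

theorem toeplitz_mulVec_apply_of_isZeroList {q w n : ℕ} {b : ℂ[T;T⁻¹]} {z : Fin w → ℂ}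
    (hz : IsZeroList (q + 1) w b z) (y : Fin n → ℂ) (j : Fin n) :
    (toeplitz n b).mulVec y j = b.coeff ((q + 1 : ℕ) : ℤ) *
      ∑ r : Fin n, zcoeff (esymmProd z) ((q : ℤ) + 1 - (j : ℕ) + (r : ℕ)) * y r := by
  rw [Matrix.mulVec, dotProduct, Finset.mul_sum]
  refine Finset.sum_congr rfl fun r _ => ?_
  rw [toeplitz, Matrix.of_apply, hz.coeff_eq, mul_assoc]
  congr 3
  push_cast
  ring


theorem theorem3 (p w n : ℕ) (hp : 1 ≤ p) (hw : 1 ≤ w) (hn : 1 ≤ n)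
    (a : ℂ[T;T⁻¹]) (ha : IsBandedSymbol p w a)
    (x : ℂ) (hx : Module.End.HasEigenvalue (Matrix.toLin' (toeplitz n a)) x) :
    -- the zeros of `a - x` exist
    (∃ z : Fin w → ℂ, IsZeroList p w (a - LaurentPolynomial.C x) z) ∧
    ∀ z : Fin w → ℂ, IsZeroList p w (a - LaurentPolynomial.C x) z →
      ∀ v : Fin n → ℂ,
        -- the index `r` runs from `0` to `n - 1`, so that `n - r` becomes `n - (r + 1)`
        (∀ r : Fin n,
          v r = schurEval (List.replicate (p - 1) (n - 1) ++ [n - ((r : ℕ) + 1)]) z) →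
        Matrix.mulVec (toeplitz n a) v = x • v ∧
        (p ≤ w → Function.Injective z →
          ∃ C : Fin w → ℂ, (∀ j : Fin w, C j = trenchCoeff n p z j) ∧
            ∀ r : Fin n, v r = ∑ j : Fin w, C j * z j ^ (n - ((r : ℕ) + 1) + (w - p))) := by
  obtain ⟨y, hy⟩ := hx.exists_hasEigenvector
  have hy0 : y ≠ 0 := hy.2
  have hyx : (toeplitz n a).mulVec y = x • y := by
    rw [← Matrix.toLin'_apply]
    exact hy.apply_eq_smul
  have hb := ha.sub_C hp hy0 hyx
  refine ⟨exists_isZeroList hb, fun z hz v hv => ?_⟩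
  obtain ⟨q, rfl⟩ : ∃ q, p = q + 1 := ⟨p - 1, by lia⟩
  rw [Nat.add_sub_cancel] at hv
  refine ⟨?_, fun hpw hinj => ⟨trenchCoeff n (q + 1) z, fun j => rfl, fun r => ?_⟩⟩
  · rw [toeplitz_mulVec_eq_smul_iff] at hyx ⊢
    have hy' : ∀ j < n,
        ∑ r : Fin n, zcoeff (esymmProd z) ((q : ℤ) + 1 - j + (r : ℕ)) * y r = 0 := by
      intro j hj
      have := congrFun hyx ⟨j, hj⟩
      rw [toeplitz_mulVec_apply_of_isZeroList hz] at this
      exact (mul_eq_zero.mp this).resolve_left hb.1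
    ext j
    rw [toeplitz_mulVec_apply_of_isZeroList hz, Pi.zero_apply]
    refine mul_eq_zero_of_right _ ?_
    rw [← sum_zcoeff_mul_det_updateRow (esymmProd_mul_hsymmSeries z) hy0 hy' j.2]
    refine Finset.sum_congr rfl fun r _ => ?_
    rw [hv, schurEval_replicate_append r.2]
  · rw [hv]
    exact schurEval_eq_sum_trenchCoeff_mul_pow hpw hn hinj
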